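/- Let $\mathcal X,\mathcal Y$ be finite sets, $\mathcal Z$ a set, and $f\colon\mathcal X\times\mathcal Y\to\mathcal Z$ a non-constant function. A (randomized, two-party) protocol is a finite protocol tree in which Alice, holding $x\in\mathcal X$, and Bob, holding $y\in\mathcal Y$, exchange bits using private and public randomness, and whose leaves carry the common output. For a probability distribution $\mu$ on $\mathcal X\times\mathcal Y$, the internal information cost of a protocol $\pi$ is $$\mathrm{IC}_\mu(\pi)=I(\Pi;X\mid Y)+I(\Pi;Y\mid X),$$ where $(X,Y)\sim\mu$ and $\Pi$ is the transcript of $\pi$ on input $(X,Y)$, including the public randomness (entropies are in bits). For $\epsilon\in[0,1]$ put $$\mathrm{IC}(f,\epsilon)=\inf_\pi\max_\mu \mathrm{IC}_\mu(\pi),$$ where the infimum is over all protocols $\pi$ with $\Pr[\pi(x,y)\ne f(x,y)]\le\epsilon$ for every $(x,y)\in\mathcal X\times\mathcal Y$, and the maximum is over all probability distributions $\mu$ on $\mathcal X\times\mathcal Y$. Let $h(\epsilon)=-\epsilon\log_2\epsilon-(1-\epsilon)\log_2(1-\epsilon)$ be the binary entropy, with $0\log_2 0=0$. **Theorem.** There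 is a constant $c>0$, depending only on $f$, such that for every $\epsilon\in[0,1]$, $$\mathrm{IC}(f,\epsilon)\le \mathrm{IC}(f,0)-c\,h(\epsilon).$$ -/

import Mathlib

namespace InfoComplexity

/-- Binary entropy in bits, `h(ε) = -ε log₂ ε - (1-ε) log₂ (1-ε)` with `0 log 0 = 0`. -/
noncomputable def h (ε : ℝ) : ℝ := Real.binEntropy ε / Real.log 2

/-- Shannon entropy in bits of a finitely supported mass function `p`
(`Real.negMulLog t = -t ln t`, with value `0` at `t = 0`). -/
noncomputable def entropy {α : Type*} [Fintype α] (p : α → ℝ) : ℝ :=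
  ∑ a, Real.negMulLog (p a) / Real.log 2

/-- Conditional mutual information `I(A;B|C) = H(AC) + H(BC) - H(ABC) - H(C)`, where `p a b c` is
the joint mass function of `(A,B,C)`. -/
noncomputable def condMutualInfo {α β γ : Type*} [Fintype α] [Fintype β] [Fintype γ]
    (p : α → β → γ → ℝ) : ℝ :=
  entropy (fun ac : α × γ => ∑ b, p ac.1 b ac.2)
    + entropy (fun bc : β × γ => ∑ a, p a bc.1 bc.2)
    - entropy (fun abc : α × β × γ => p abc.1 abc.2.1 abc.2.2)
    - entropy (fun c : γ => ∑ a, ∑ b, p a b c)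

/-- Randomized two-party communication protocols, as protocol trees. A leaf carries the output on
which the players agree. At a node `alice p π₀ π₁` Alice, holding the input `x`, sends the bit `1`
with probability `p x` (using her private randomness), and the players continue with `π₁` if the
bit is `1` and with `π₀` if it is `0`; `bob p π₀ π₁` is the same for Bob. A node `coin q π₀ π₁`
reads a public random bit, equal to `1` with probability `q`.

The law of a transcript depends on the private random strings only through the conditional
probability of the next bit given the sender's input and the earlier transcript, so the numbers
`p x` describe private strings of arbitrary distribution. -/
inductive Protocol (X Y Z : Type*) where
  | leaf (z : Z) : Protocol X Y Z
  | alice (p : X → unitInterval) (π₀ π₁ : Protocol X Y Z) : Protocol X Y Z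
  | bob (p : Y → unitInterval) (π₀ π₁ : Protocol X Y Z) : Protocol X Y Z
  | coin (q : unitInterval) (π₀ π₁ : Protocol X Y Z) : Protocol X Y Z

namespace Protocol

variable {X Y Z : Type*}

/-- Transcripts are the root-to-leaf paths of the tree: the list of all bits sent and of all public
random bits. `Sum.inl` records a bit `0`, `Sum.inr` a bit `1`. -/
def Transcript : Protocol X Y Z → Type
  | leaf _ => Unit
  | alice _ π₀ π₁ => π₀.Transcript ⊕ π₁.Transcript
  | bob _ π₀ π₁ => π₀.Transcript ⊕ π₁.Transcript
  | coin _ π₀ π₁ => π₀.Transcript ⊕ π₁.Transcript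

/-- A protocol has finitely many transcripts. -/
instance instFintypeTranscript : (π : Protocol X Y Z) → Fintype π.Transcript
  | leaf _ => inferInstanceAs (Fintype Unit)
  | alice _ π₀ π₁ =>
    @instFintypeSum _ _ (instFintypeTranscript π₀) (instFintypeTranscript π₁)
  | bob _ π₀ π₁ =>
    @instFintypeSum _ _ (instFintypeTranscript π₀) (instFintypeTranscript π₁)
  | coin _ π₀ π₁ =>
    @instFintypeSum _ _ (instFintypeTranscript π₀) (instFintypeTranscript π₁)

/-- The output of the protocol, a function of the transcript. -/
def output : (π : Protocol X Y Z) → π.Transcript → Z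
  | leaf z, _ => z
  | alice _ π₀ _, Sum.inl t => π₀.output t
  | alice _ _ π₁, Sum.inr t => π₁.output t
  | bob _ π₀ _, Sum.inl t => π₀.output t
  | bob _ _ π₁, Sum.inr t => π₁.output t
  | coin _ π₀ _, Sum.inl t => π₀.output t
  | coin _ _ π₁, Sum.inr t => π₁.output t

/-- `π.prob x y t` is the probability that the transcript of `π` on the input `(x, y)` is `t`. -/
def prob : (π : Protocol X Y Z) → X → Y → π.Transcript → ℝ
  | leaf _, _, _, _ => 1
  | alice p π₀ _, x, y, Sum.inl t => (1 - (p x : ℝ)) * π₀.prob x y t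
  | alice p _ π₁, x, y, Sum.inr t => (p x : ℝ) * π₁.prob x y t
  | bob p π₀ _, x, y, Sum.inl t => (1 - (p y : ℝ)) * π₀.prob x y t
  | bob p _ π₁, x, y, Sum.inr t => (p y : ℝ) * π₁.prob x y t
  | coin q π₀ _, x, y, Sum.inl t => (1 - (q : ℝ)) * π₀.prob x y t
  | coin q _ π₁, x, y, Sum.inr t => (q : ℝ) * π₁.prob x y t

open Classical in
/-- The probability that the output of `π` on the input `(x, y)` differs from `f (x, y)`. -/
noncomputable def errorProb (π : Protocol X Y Z) (f : X × Y → Z) (x : X) (y : Y) : ℝ :=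
  ∑ t : π.Transcript, if π.output t ≠ f (x, y) then π.prob x y t else 0

/-- `π` performs the task `[f, ε]`: on every input it errs with probability at most `ε`. -/
def Performs (π : Protocol X Y Z) (f : X × Y → Z) (ε : ℝ) : Prop :=
  ∀ x y, π.errorProb f x y ≤ ε

/-- The internal information cost `IC_μ(π) = I(Π;X|Y) + I(Π;Y|X)` of `π`, where `(X,Y)` has the
mass function `μ` and `Π` is the transcript of `π` on the input `(X,Y)`. -/
noncomputable def infoCost [Fintype X] [Fintype Y] (μ : X × Y → ℝ) (π : Protocol X Y Z) : ℝ :=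
  condMutualInfo (fun (t : π.Transcript) (x : X) (y : Y) => μ (x, y) * π.prob x y t)
    + condMutualInfo (fun (t : π.Transcript) (y : Y) (x : X) => μ (x, y) * π.prob x y t)

/-- `max_μ IC_μ(π)`, over all probability distributions `μ` on `X × Y`. -/
noncomputable def maxInfoCost [Fintype X] [Fintype Y] (π : Protocol X Y Z) : ℝ :=
  ⨆ μ : stdSimplex ℝ (X × Y), infoCost (μ : X × Y → ℝ) π

end Protocol

/-- The prior-free information complexity `IC(f,ε) = inf_π max_μ IC_μ(π)` of `f` with error `ε`,
the infimum being over all protocols that perform the task `[f, ε]`. -/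
noncomputable def IC {X Y Z : Type*} [Fintype X] [Fintype Y] (f : X × Y → Z) (ε : ℝ) : ℝ :=
  ⨅ π : {π : Protocol X Y Z // π.Performs f ε}, π.1.maxInfoCost

end InfoComplexity

/-! Run an exact protocol `π` on privately randomized inputs. Alice replaces `x` by `X'`, which
equals `g x` with probability at least `1 - e` and takes every value with probability at least `e /
N`, where `N = |X| + |Y|`; Bob does likewise with `k`. If `g` and `k` preserve the values of `f`,
the error is at most `2e`. No coordination is needed: each bit can be sampled from its posterior law
given the sender's true input and the earlier transcript (`exists_simulation`).

The cost of the new protocol under `μ` is at most the cost of `π` under the law `ν` of the noisy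
inputs, minus what the transcript reveals about the noise (`tableCost_noise_add_le`). Since `π` is
exact, its transcript shows whether the noise changed the value of `f`. At an input where a player
can change the value, this event has probability between `e / N` and `1 - e / N`, so at least the
binary entropy of `e / N` is saved there (`le_noiseGain`). The total saving is of order `h e` times
the mass of sensitive inputs.

This gives nothing when `μ` sits on inputs that neither player can change. All of these share one
value of `f`, so `g` and `k` can send them all to one pair `(x₀, y₀)` (`exists_merge`). For such
`μ`, the law `ν` is nearly a point mass and the cost is at most its small input entropy, whereas the
exact complexity is at least `1 / (4N)` (`le_IC_zero`). Either way the saving is at least a constant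
times `h ε` for small `ε`; monotonicity in the error handles the rest. -/

namespace InfoComplexity

/-! ### Homogeneous entropy and mutual information of unnormalized vectors. -/

section Entropy

open Real

variable {T B J : Type*} [Fintype T] [Fintype B] [Fintype J]

/-- The extension of the entropy (in nats) to a homogeneous function of degree one on
nonnegative vectors. -/
noncomputable def homEntropy (a : T → ℝ) : ℝ := ∑ t, negMulLog (a t) - negMulLog (∑ t, a t)

lemma homEntropy_smul (c : ℝ) (a : T → ℝ) :
    homEntropy (fun t => c * a t) = c * homEntropy a := by
  simp only [homEntropy, ← Finset.mul_sum, negMulLog_mul, Finset.sum_add_distrib,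
    ← Finset.sum_mul]
  ring

lemma homEntropy_comp_equiv {T' : Type*} [Fintype T'] (e : T' ≃ T) (a : T → ℝ) :
    homEntropy (fun t => a (e t)) = homEntropy a := by
  simp only [homEntropy, Equiv.sum_comp e a, Equiv.sum_comp e (fun t => negMulLog (a t))]

lemma homEntropy_nonneg {a : T → ℝ} (ha : ∀ t, 0 ≤ a t) : 0 ≤ homEntropy a := by
  have hle : ∀ t, a t ≤ ∑ s, a s := fun t =>
    Finset.single_le_sum (fun s _ => ha s) (Finset.mem_univ t)
  have : homEntropy a = ∑ t, a t * (log (∑ s, a s) - log (a t)) := by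
    simp only [homEntropy, negMulLog, mul_sub, Finset.sum_sub_distrib, ← Finset.sum_mul]
    simp only [neg_mul, Finset.sum_neg_distrib]
    ring
  rw [this]
  refine Finset.sum_nonneg fun t _ => ?_
  rcases (ha t).eq_or_lt with h0 | h0
  · simp [← h0]
  · exact mul_nonneg h0.le (sub_nonneg.2 (log_le_log h0 (hle t)))

/-- The log-sum inequality. -/
lemma negMulLog_add_mul_log_add_le {a b s r : ℝ} (ha : 0 ≤ a) (hb : 0 ≤ b) (hs : a ≤ s)
    (hr : b ≤ r) :
    (negMulLog a + a * log s) + (negMulLog b + b * log r)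
      ≤ negMulLog (a + b) + (a + b) * log (s + r) := by
  rcases (ha.trans hs).eq_or_lt with h0 | h0
  · have : a = 0 := le_antisymm (hs.trans h0.symm.le) ha
    simp [this, ← h0]
  rcases (hb.trans hr).eq_or_lt with h1 | h1
  · have : b = 0 := le_antisymm (hr.trans h1.symm.le) hb
    simp [this, ← h1]
  have key : ∀ u v : ℝ, 0 < v → negMulLog u + u * log v = v * negMulLog (u / v) := by
    intro u v hv
    rcases eq_or_ne u 0 with rfl | hu
    · simp
    · rw [negMulLog, negMulLog, log_div hu hv.ne']
      field_simp
      ring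
  rw [key _ _ h0, key _ _ h1, key _ _ (add_pos h0 h1)]
  have hc := concaveOn_negMulLog.2 (Set.mem_Ici.2 (div_nonneg ha h0.le))
    (Set.mem_Ici.2 (div_nonneg hb h1.le)) (show 0 ≤ s / (s + r) by positivity)
    (show 0 ≤ r / (s + r) by positivity) (by field_simp)
  have harg : (s / (s + r)) • (a / s) + (r / (s + r)) • (b / r) = (a + b) / (s + r) := by
    simp only [smul_eq_mul]; field_simp
  rw [harg] at hc
  simp only [smul_eq_mul] at hc
  have := mul_le_mul_of_nonneg_left hc (add_pos h0 h1).le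
  refine le_trans (le_of_eq ?_) this
  field_simp

/-- For a function homogeneous of degree one, concavity is superadditivity. The log-sum inequality
gives it coordinate by coordinate. -/
lemma homEntropy_add_le {a b : T → ℝ} (ha : ∀ t, 0 ≤ a t) (hb : ∀ t, 0 ≤ b t) :
    homEntropy a + homEntropy b ≤ homEntropy (fun t => a t + b t) := by
  have key : ∀ c : T → ℝ, homEntropy c
      = ∑ t, (negMulLog (c t) + c t * log (∑ s, c s)) := by
    intro c
    rw [homEntropy, Finset.sum_add_distrib, ← Finset.sum_mul, negMulLog]
    ring
  rw [key, key, key, ← Finset.sum_add_distrib, Finset.sum_add_distrib (f := a)]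
  refine Finset.sum_le_sum fun t _ => negMulLog_add_mul_log_add_le (ha t) (hb t) ?_ ?_
  · exact Finset.single_le_sum (fun s _ => ha s) (Finset.mem_univ t)
  · exact Finset.single_le_sum (fun s _ => hb s) (Finset.mem_univ t)

lemma sum_homEntropy_le {ι : Type*} (s : Finset ι) {a : ι → T → ℝ} (ha : ∀ j t, 0 ≤ a j t) :
    ∑ j ∈ s, homEntropy (a j) ≤ homEntropy (fun t => ∑ j ∈ s, a j t) := by
  classical
  induction s using Finset.induction_on with
  | empty => simp [homEntropy]
  | insert i s hi ih =>
    simp only [Finset.sum_insert hi]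
    refine le_trans (add_le_add_right ih _)
      (homEntropy_add_le (ha i) fun t => Finset.sum_nonneg fun j _ => ha j t)

/-- Chain rule: with disjoint supports the sample determines which summand it came from, and the
bracket is the entropy of that choice. -/
lemma homEntropy_add_of_mul_eq_zero {a b : T → ℝ} (hab : ∀ t, a t * b t = 0) :
    homEntropy (fun t => a t + b t) = homEntropy a + homEntropy b
      + (negMulLog (∑ t, a t) + negMulLog (∑ t, b t) - negMulLog (∑ t, a t + ∑ t, b t)) := by
  have : ∀ t, negMulLog (a t + b t) = negMulLog (a t) + negMulLog (b t) := by
    intro t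
    rcases mul_eq_zero.1 (hab t) with h | h <;> simp [h]
  simp only [homEntropy, this, Finset.sum_add_distrib]
  ring

/-- The mutual information of the two coordinates, extended to a homogeneous function of degree
one on nonnegative matrices. -/
noncomputable def homMutualInfo (m : T → B → ℝ) : ℝ :=
  homEntropy (fun t => ∑ b, m t b) - ∑ b, homEntropy (fun t => m t b)

lemma homMutualInfo_comp_equiv {T' : Type*} [Fintype T'] (e : T' ≃ T) (m : T → B → ℝ) :
    homMutualInfo (fun t => m (e t)) = homMutualInfo m := by
  rw [homMutualInfo, homMutualInfo, homEntropy_comp_equiv e (fun t => ∑ b, m t b),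
    Finset.sum_congr rfl fun b _ => homEntropy_comp_equiv e (fun t => m t b)]

lemma homMutualInfo_comm (m : T → B → ℝ) :
    homMutualInfo m = homMutualInfo (fun b t => m t b) := by
  simp only [homMutualInfo, homEntropy, Finset.sum_sub_distrib]
  rw [Finset.sum_comm (f := fun t b => m t b),
    Finset.sum_comm (f := fun t b => negMulLog (m t b))]
  ring

lemma homMutualInfo_nonneg {m : T → B → ℝ} (hm : ∀ t b, 0 ≤ m t b) : 0 ≤ homMutualInfo m :=
  sub_nonneg.2 (sum_homEntropy_le _ fun b t => hm t b)

lemma homMutualInfo_le {m : T → B → ℝ} (hm : ∀ t b, 0 ≤ m t b) :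
    homMutualInfo m ≤ homEntropy (fun b => ∑ t, m t b) := by
  rw [homMutualInfo_comm, homMutualInfo]
  exact sub_le_self _ (Finset.sum_nonneg fun t _ => homEntropy_nonneg (hm t))

/-- Mutual information is convex in the channel. -/
lemma homMutualInfo_sum_le {m : J → T → B → ℝ} (hm : ∀ j t b, 0 ≤ m j t b) (c : J → ℝ)
    (v : B → ℝ) (hv : ∀ j b, ∑ t, m j t b = c j * v b) :
    homMutualInfo (fun t b => ∑ j, m j t b) ≤ ∑ j, homMutualInfo (m j) := by
  rw [homMutualInfo_comm, Finset.sum_congr rfl fun j _ => homMutualInfo_comm (m j)]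
  simp only [homMutualInfo, Finset.sum_sub_distrib]
  have h1 : ∀ b, ∑ t, ∑ j, m j t b = (∑ j, c j) * v b := by
    intro b
    rw [Finset.sum_comm, Finset.sum_mul]
    exact Finset.sum_congr rfl fun j _ => hv j b
  simp only [h1, hv, homEntropy_smul, ← Finset.sum_mul]
  rw [Finset.sum_comm]
  exact sub_le_sub_left (Finset.sum_le_sum fun t _ => sum_homEntropy_le _ fun j b => hm j t b) _

/-- Mutual information is concave in the input distribution. -/
lemma sum_homMutualInfo_le {c : J → B → ℝ} {w : T → B → ℝ} (hc : ∀ j b, 0 ≤ c j b)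
    (hw : ∀ t b, 0 ≤ w t b) :
    ∑ j, homMutualInfo (fun t b => c j b * w t b)
      ≤ homMutualInfo (fun t b => (∑ j, c j b) * w t b) := by
  simp only [homMutualInfo, homEntropy_smul, Finset.sum_sub_distrib]
  rw [Finset.sum_comm]
  simp only [← Finset.sum_mul]
  refine sub_le_sub_right ((sum_homEntropy_le _ fun j t => Finset.sum_nonneg fun b _ =>
    mul_nonneg (hc j b) (hw t b)).trans_eq ?_) _
  congr 1
  ext t
  rw [Finset.sum_comm]
  simp only [Finset.sum_mul]

/-- Homogeneity absorbs the probability of the condition, so conditioning becomes a plain sum over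
slices with no division. -/
lemma condMutualInfo_eq {α β γ : Type*} [Fintype α] [Fintype β] [Fintype γ]
    (p : α → β → γ → ℝ) :
    condMutualInfo p = (∑ c, homMutualInfo (fun a b => p a b c)) / log 2 := by
  simp only [condMutualInfo, entropy, homMutualInfo, homEntropy, ← Finset.sum_div, ← add_div,
    ← sub_div, Fintype.sum_prod_type, Finset.sum_sub_distrib]
  congr 1
  rw [Finset.sum_comm (f := fun a c => negMulLog (∑ b, p a b c)),
    Finset.sum_comm (f := fun b c => negMulLog (∑ a, p a b c))]
  have h1 : ∑ a, ∑ b, ∑ c, negMulLog (p a b c) = ∑ c, ∑ b, ∑ a, negMulLog (p a b c) := by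
    rw [Finset.sum_comm' (t' := Finset.univ) (s' := fun _ => Finset.univ) (by simp),
      Finset.sum_comm' (s := Finset.univ) (t' := Finset.univ) (s' := fun _ => Finset.univ)
        (by simp)]
    simp only [Finset.sum_comm (s := (Finset.univ : Finset α))]
    rw [Finset.sum_comm]
  have h2 : ∀ c, ∑ a, ∑ b, p a b c = ∑ b, ∑ a, p a b c := fun c => Finset.sum_comm
  rw [h1]
  simp only [h2]
  ring

end Entropy

/-! ### Information cost of a transcript table and the effect of input noise. -/

section Cost

open Real

variable {T X Y : Type*} [Fintype T] [Fintype X] [Fintype Y]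

/-- The internal information cost, in nats, of a transcript with conditional law `P` when the
inputs have the law `μ`. -/
noncomputable def tableCost (μ : X → Y → ℝ) (P : T → X → Y → ℝ) : ℝ :=
  ∑ y, homMutualInfo (fun t x => μ x y * P t x y)
    + ∑ x, homMutualInfo (fun t y => μ x y * P t x y)

lemma tableCost_swap (μ : X → Y → ℝ) (P : T → X → Y → ℝ) :
    tableCost (fun y x => μ x y) (fun t y x => P t x y) = tableCost μ P :=
  add_comm _ _

lemma tableCost_comp_equiv {T' : Type*} [Fintype T'] (e : T' ≃ T) (μ : X → Y → ℝ)
    (P : T → X → Y → ℝ) : tableCost μ (fun t => P (e t)) = tableCost μ P := by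
  unfold tableCost
  congr 1
  · exact Finset.sum_congr rfl fun y _ => homMutualInfo_comp_equiv e fun t x => μ x y * P t x y
  · exact Finset.sum_congr rfl fun x _ => homMutualInfo_comp_equiv e fun t y => μ x y * P t x y

lemma tableCost_nonneg {μ : X → Y → ℝ} {P : T → X → Y → ℝ} (hμ : ∀ x y, 0 ≤ μ x y)
    (hP : ∀ t x y, 0 ≤ P t x y) : 0 ≤ tableCost μ P :=
  add_nonneg
    (Finset.sum_nonneg fun y _ => homMutualInfo_nonneg fun t x => mul_nonneg (hμ x y) (hP t x y))
    (Finset.sum_nonneg fun x _ => homMutualInfo_nonneg fun t y => mul_nonneg (hμ x y) (hP t x y))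

/-- The sum `H(X|Y) + H(Y|X)` of the conditional entropies of the inputs, in nats. -/
noncomputable def inputEntropy (μ : X → Y → ℝ) : ℝ :=
  ∑ y, homEntropy (fun x => μ x y) + ∑ x, homEntropy (μ x)

lemma tableCost_le_inputEntropy {μ : X → Y → ℝ} {P : T → X → Y → ℝ} (hμ : ∀ x y, 0 ≤ μ x y)
    (hP : ∀ t x y, 0 ≤ P t x y) (hP1 : ∀ x y, ∑ t, P t x y = 1) :
    tableCost μ P ≤ inputEntropy μ := by
  refine add_le_add (Finset.sum_le_sum fun y _ => ?_) (Finset.sum_le_sum fun x _ => ?_)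
  · refine (homMutualInfo_le fun t x => mul_nonneg (hμ x y) (hP t x y)).trans_eq ?_
    simp only [← Finset.mul_sum, hP1, mul_one]
  · refine (homMutualInfo_le fun t y => mul_nonneg (hμ x y) (hP t x y)).trans_eq ?_
    simp only [← Finset.mul_sum, hP1, mul_one]

lemma continuous_inputEntropy :
    Continuous (fun μ : X → Y → ℝ => inputEntropy μ) := by
  unfold inputEntropy homEntropy
  have := continuous_negMulLog
  fun_prop

/-- The information about the noisy input `X' ∼ K(X)` of Alice that the transcript reveals to
an observer of both true inputs. -/
noncomputable def noiseGain (μ : X → Y → ℝ) (K : X → X → ℝ) (P : T → X → Y → ℝ) : ℝ :=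
  ∑ x, ∑ y, μ x y * (homEntropy (fun t => ∑ x', K x x' * P t x' y)
    - ∑ x', K x x' * homEntropy (fun t => P t x' y))

/-- Replacing Alice's input by a noisy version of it lowers the information cost by at least
`noiseGain`. -/
lemma tableCost_noise_add_le {μ : X → Y → ℝ} {K : X → X → ℝ} {P : T → X → Y → ℝ}
    (hμ : ∀ x y, 0 ≤ μ x y) (hK : ∀ x x', 0 ≤ K x x')
    (hP : ∀ t x y, 0 ≤ P t x y) (hP1 : ∀ x y, ∑ t, P t x y = 1) :
    tableCost μ (fun t x y => ∑ x', K x x' * P t x' y) + noiseGain μ K P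
      ≤ tableCost (fun x' y => ∑ x, μ x y * K x x') P := by
  -- Chain rule for the Markov chain from `X` through `X'` to the transcript, given `Y`: I(T;X'|Y) =
  -- I(T;X|Y) + I(T;X'|X,Y).
  have h1 : ∑ y, homMutualInfo (fun t x => μ x y * ∑ x', K x x' * P t x' y) + noiseGain μ K P
      = ∑ y, homMutualInfo (fun t x' => (∑ x, μ x y * K x x') * P t x' y) := by
    rw [noiseGain, Finset.sum_comm, ← Finset.sum_add_distrib]
    refine Finset.sum_congr rfl fun y _ => ?_
    simp only [homMutualInfo, homEntropy_smul, mul_sub, Finset.sum_sub_distrib]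
    have e1 : ∀ t, ∑ x, μ x y * ∑ x', K x x' * P t x' y
        = ∑ x', (∑ x, μ x y * K x x') * P t x' y := by
      intro t
      simp only [Finset.mul_sum, Finset.sum_mul]
      rw [Finset.sum_comm]
      simp only [mul_assoc]
    have e2 : ∑ x, μ x y * ∑ x', K x x' * homEntropy (fun t => P t x' y)
        = ∑ x', (∑ x, μ x y * K x x') * homEntropy (fun t => P t x' y) := by
      simp only [Finset.mul_sum, Finset.sum_mul]
      rw [Finset.sum_comm]
      simp only [mul_assoc]
    simp only [e1, e2]
    ring
  -- Given `X`, the noise is independent of `Y`, so convexity in the channel permits conditioning on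
  -- `X'` as well; concavity in the law of `Y` then permits forgetting `X`.
  have h2 : ∑ x, homMutualInfo (fun t y => μ x y * ∑ x', K x x' * P t x' y)
      ≤ ∑ x', homMutualInfo (fun t y => (∑ x, μ x y * K x x') * P t x' y) := by
    calc ∑ x, homMutualInfo (fun t y => μ x y * ∑ x', K x x' * P t x' y)
        ≤ ∑ x, ∑ x', homMutualInfo (fun t y => (μ x y * K x x') * P t x' y) := by
          refine Finset.sum_le_sum fun x _ => ?_
          have := homMutualInfo_sum_le (m := fun x' t y => (μ x y * K x x') * P t x' y)
            (fun x' t y => mul_nonneg (mul_nonneg (hμ x y) (hK x x')) (hP t x' y)) (K x) (μ x)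
            (fun x' y => by rw [← Finset.mul_sum, hP1, mul_one, mul_comm])
          simpa only [Finset.mul_sum, mul_assoc] using this
      _ ≤ _ := by
          rw [Finset.sum_comm]
          exact Finset.sum_le_sum fun x' _ => sum_homMutualInfo_le
            (fun x y => mul_nonneg (hμ x y) (hK x x')) (fun t y => hP t x' y)
  have := add_le_add h1.le h2
  unfold tableCost
  linarith

end Cost


/-! ### Sensitive inputs. -/

section Sensitive

variable {X Y Z : Type*}

open Classical in
/-- The indicator of the inputs at which a change of Alice's input can change the value. -/
noncomputable def sensitiveLeft (f : X → Y → Z) (x : X) (y : Y) : ℝ :=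
  if ∃ x', f x' y ≠ f x y then 1 else 0

lemma sensitiveLeft_nonneg (f : X → Y → Z) (x : X) (y : Y) : 0 ≤ sensitiveLeft f x y := by
  unfold sensitiveLeft
  split_ifs <;> norm_num

end Sensitive

/-! ### Lower bounds for the information saved by noise. -/

section Gain

open Real

variable {T X Y Z : Type*} [Fintype T] [Fintype X] [Fintype Y]

/-- A noisy choice between two groups of perfectly distinguishable distributions is revealed by
the sample. -/
lemma binEntropy_le_homEntropy_mixture {ι : Type*} [Fintype ι] {w : ι → ℝ} (hw : ∀ i, 0 ≤ w i)
    (hw1 : ∑ i, w i = 1) {p : ι → T → ℝ} (hp : ∀ i t, 0 ≤ p i t) (hp1 : ∀ i, ∑ t, p i t = 1)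
    (E : ι → Prop) [DecidablePred E] (hE : ∀ i j t, E i → ¬ E j → p i t * p j t = 0) :
    binEntropy (∑ i with E i, w i)
      ≤ homEntropy (fun t => ∑ i, w i * p i t) - ∑ i, w i * homEntropy (p i) := by
  have hnn : ∀ i t, 0 ≤ w i * p i t := fun i t => mul_nonneg (hw i) (hp i t)
  have hsplit : ∀ t, ∑ i, w i * p i t
      = ∑ i with E i, w i * p i t + ∑ i with ¬ E i, w i * p i t :=
    fun t => (Finset.sum_filter_add_sum_filter_not _ _ _).symm
  have hmass : ∀ s : Finset ι, ∑ t, ∑ i ∈ s, w i * p i t = ∑ i ∈ s, w i := by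
    intro s
    rw [Finset.sum_comm]
    simp only [← Finset.mul_sum, hp1, mul_one]
  have hq : ∑ i with ¬ E i, w i = 1 - ∑ i with E i, w i := by
    rw [← hw1, ← Finset.sum_filter_add_sum_filter_not Finset.univ E]
    ring
  simp only [hsplit]
  rw [homEntropy_add_of_mul_eq_zero, hmass, hmass, hq,
    ← Finset.sum_filter_add_sum_filter_not Finset.univ E (fun i => w i * homEntropy (p i)),
    binEntropy_eq_negMulLog_add_negMulLog_one_sub]
  · have h1 := sum_homEntropy_le (Finset.univ.filter E) hnn
    have h2 := sum_homEntropy_le (Finset.univ.filter fun i => ¬ E i) hnn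
    simp only [homEntropy_smul] at h1 h2
    have h3 : negMulLog (∑ i with E i, w i + (1 - ∑ i with E i, w i)) = 0 := by simp
    rw [h3]
    linarith
  · intro t
    rw [Finset.sum_mul_sum]
    refine Finset.sum_eq_zero fun i hi => Finset.sum_eq_zero fun j hj => ?_
    rw [mul_mul_mul_comm, hE i j t (Finset.mem_filter.1 hi).2 (Finset.mem_filter.1 hj).2, mul_zero]

lemma noiseGain_nonneg {μ : X → Y → ℝ} {K : X → X → ℝ} {P : T → X → Y → ℝ}
    (hμ : ∀ x y, 0 ≤ μ x y) (hK : ∀ x x', 0 ≤ K x x') (hP : ∀ t x y, 0 ≤ P t x y) :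
    0 ≤ noiseGain μ K P := by
  refine Finset.sum_nonneg fun x _ => Finset.sum_nonneg fun y _ => mul_nonneg (hμ x y) ?_
  have := sum_homEntropy_le Finset.univ (a := fun x' t => K x x' * P t x' y)
    (fun x' t => mul_nonneg (hK x x') (hP t x' y))
  simpa only [homEntropy_smul, sub_nonneg] using this

lemma tableCost_noise_right_add_le {μ : X → Y → ℝ} {L : Y → Y → ℝ} {P : T → X → Y → ℝ}
    (hμ : ∀ x y, 0 ≤ μ x y) (hL : ∀ y y', 0 ≤ L y y')
    (hP : ∀ t x y, 0 ≤ P t x y) (hP1 : ∀ x y, ∑ t, P t x y = 1) :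
    tableCost μ (fun t x y => ∑ y', L y y' * P t x y')
        + noiseGain (fun y x => μ x y) L (fun t y x => P t x y)
      ≤ tableCost (fun x y' => ∑ y, μ x y * L y y') P := by
  have := tableCost_noise_add_le (μ := fun y x => μ x y) (P := fun t y x => P t x y)
    (fun y x => hμ x y) hL (fun t y x => hP t x y) (fun y x => hP1 x y)
  rwa [tableCost_swap μ (fun t x y => ∑ y', L y y' * P t x y'),
    tableCost_swap (fun x y' => ∑ y, μ x y * L y y') P] at this

/-- A stochastic matrix which sends `x` to `g x` with probability at least `1 - e` and to every
other point with probability at least `a`. -/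
structure IsNoise (K : X → X → ℝ) (g : X → X) (e a : ℝ) : Prop where
  nonneg : ∀ x x', 0 ≤ K x x'
  sum_eq_one : ∀ x, ∑ x', K x x' = 1
  one_sub_le : ∀ x, 1 - e ≤ K x (g x)
  le_apply : ∀ x x', a ≤ K x x'

open Classical in
lemma exists_isNoise [Nonempty X] (g : X → X) {e a : ℝ} (he : 0 ≤ e) (he1 : e ≤ 1)
    (ha : a * Fintype.card X ≤ e) : ∃ K, IsNoise K g e a := by
  have hc : (0 : ℝ) < Fintype.card X := Nat.cast_pos.2 Fintype.card_pos
  have h0 : 0 ≤ e / Fintype.card X := by positivity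
  have h1 : ∀ x x', 0 ≤ if x' = g x then 1 - e else 0 := by
    intro x x'
    split_ifs <;> linarith
  refine ⟨fun x x' => (if x' = g x then 1 - e else 0) + e / Fintype.card X, fun x x' => ?_,
    fun x => ?_, fun x => ?_, fun x x' => ?_⟩
  · have := h1 x x'
    positivity
  · rw [Finset.sum_add_distrib]
    simp only [Finset.sum_ite_eq', Finset.mem_univ, if_true, Finset.sum_const, Finset.card_univ,
      nsmul_eq_mul]
    field_simp
    ring
  · simpa using h0
  · have : a ≤ e / Fintype.card X := (le_div_iff₀ hc).2 ha
    linarith [h1 x x']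

lemma binEntropy_le_of_mem_Icc {a q : ℝ} (ha : 0 ≤ a) (h1 : a ≤ q) (h2 : q ≤ 1 - a) :
    binEntropy a ≤ binEntropy q := by
  have := strictConcave_binEntropy.concaveOn.min_le_of_mem_Icc (x := a) (y := 1 - a) (z := q)
    ⟨ha, by linarith⟩ ⟨by linarith, by linarith⟩ ⟨h1, h2⟩
  simpa using this

-- The output reveals whether `f x' y = f x y`. At a sensitive input this event has probability at
-- least `1 - e`, because of `g x`, and its complement at least `a`, because some `x'` changes the
-- value.
open Classical in
lemma le_noiseGain {μ : X → Y → ℝ} {K : X → X → ℝ} {P : T → X → Y → ℝ} {f : X → Y → Z}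
    {out : T → Z} {g : X → X} {e a : ℝ}
    (hμ : ∀ x y, 0 ≤ μ x y) (hK : IsNoise K g e a) (ha : 0 ≤ a) (hae : a ≤ 1 - e)
    (hg : ∀ x y, f (g x) y = f x y)
    (hP : ∀ t x y, 0 ≤ P t x y) (hP1 : ∀ x y, ∑ t, P t x y = 1)
    (hf : ∀ t x y, P t x y ≠ 0 → out t = f x y) :
    binEntropy a * ∑ x, ∑ y, μ x y * sensitiveLeft f x y ≤ noiseGain μ K P := by
  simp only [noiseGain, Finset.mul_sum]
  refine Finset.sum_le_sum fun x _ => Finset.sum_le_sum fun y _ => ?_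
  rw [mul_left_comm]
  refine mul_le_mul_of_nonneg_left ?_ (hμ x y)
  have key := binEntropy_le_homEntropy_mixture (hK.nonneg x) (hK.sum_eq_one x)
    (p := fun x' t => P t x' y) (fun x' t => hP t x' y) (fun x' => hP1 x' y)
    (fun x' => f x' y = f x y) (by
      intro i j t hi hj
      by_contra hne
      have h1 := hf t i y (left_ne_zero_of_mul hne)
      have h2 := hf t j y (right_ne_zero_of_mul hne)
      exact hj (h2.symm.trans (h1.trans hi)))
  refine le_trans ?_ key
  have hle : ∀ i, K x i ≤ ∑ i, K x i := fun i =>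
    Finset.single_le_sum (fun j _ => hK.nonneg x j) (Finset.mem_univ i)
  have hsub := Finset.sum_filter_add_sum_filter_not Finset.univ (fun x' => f x' y = f x y) (K x)
  rw [hK.sum_eq_one] at hsub
  have hlow : 1 - e ≤ ∑ x' with f x' y = f x y, K x x' :=
    (hK.one_sub_le x).trans (Finset.single_le_sum (f := K x) (fun j _ => hK.nonneg x j)
      (Finset.mem_filter.2 ⟨Finset.mem_univ _, hg x y⟩))
  unfold sensitiveLeft
  split_ifs with h
  · obtain ⟨x₂, h₂⟩ := h
    have h3 : a ≤ ∑ x' with ¬ f x' y = f x y, K x x' :=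
      (hK.le_apply x x₂).trans (Finset.single_le_sum (f := K x) (fun j _ => hK.nonneg x j)
        (Finset.mem_filter.2 ⟨Finset.mem_univ _, h₂⟩))
    rw [mul_one]
    exact binEntropy_le_of_mem_Icc ha (hae.trans hlow) (by linarith)
  · rw [mul_zero]
    refine binEntropy_nonneg (by linarith) ?_
    have : 0 ≤ ∑ x' with ¬ f x' y = f x y, K x x' :=
      Finset.sum_nonneg fun j _ => hK.nonneg x j
    linarith

/-- Noise on Bob's side which preserves the value hardly lowers the mass of sensitive inputs. -/
lemma le_sum_noise_mul_sensitiveLeft {μ : X → Y → ℝ} {L : Y → Y → ℝ} {f : X → Y → Z}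
    {k : Y → Y} {e a : ℝ} (hμ : ∀ x y, 0 ≤ μ x y) (hL : IsNoise L k e a)
    (hk : ∀ x y, f x (k y) = f x y) :
    (1 - e) * ∑ x, ∑ y, μ x y * sensitiveLeft f x y
      ≤ ∑ x, ∑ y', (∑ y, μ x y * L y y') * sensitiveLeft f x y' := by
  simp only [Finset.mul_sum, Finset.sum_mul]
  refine Finset.sum_le_sum fun x _ => ?_
  rw [Finset.sum_comm]
  refine Finset.sum_le_sum fun y _ => ?_
  have hs : sensitiveLeft f x (k y) = sensitiveLeft f x y := by
    unfold sensitiveLeft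
    congr 1
    simp only [hk]
  have := Finset.single_le_sum (s := Finset.univ)
    (f := fun y' => μ x y * L y y' * sensitiveLeft f x y')
    (fun y' _ => mul_nonneg (mul_nonneg (hμ x y) (hL.nonneg y y')) (sensitiveLeft_nonneg f x y'))
    (Finset.mem_univ (k y))
  refine le_trans ?_ this
  simp only [hs]
  have h1 := mul_le_mul_of_nonneg_right (hL.one_sub_le y)
    (mul_nonneg (hμ x y) (sensitiveLeft_nonneg f x y))
  linarith

/-- The law of the noisy inputs. -/
def noisyLaw (μ : X → Y → ℝ) (K : X → X → ℝ) (L : Y → Y → ℝ) (x' : X) (y' : Y) : ℝ :=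
  ∑ y, (∑ x, μ x y * K x x') * L y y'

/-- The law of the transcript when the players first replace their inputs by noisy ones. -/
def noisyTable (P : T → X → Y → ℝ) (K : X → X → ℝ) (L : Y → Y → ℝ) (t : T) (x : X) (y : Y) : ℝ :=
  ∑ x', K x x' * ∑ y', L y y' * P t x' y'

lemma noisyLaw_nonneg {μ : X → Y → ℝ} {K : X → X → ℝ} {L : Y → Y → ℝ} (hμ : ∀ x y, 0 ≤ μ x y)
    (hK : ∀ x x', 0 ≤ K x x') (hL : ∀ y y', 0 ≤ L y y') (x : X) (y : Y) :
    0 ≤ noisyLaw μ K L x y :=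
  Finset.sum_nonneg fun _ _ => mul_nonneg
    (Finset.sum_nonneg fun _ _ => mul_nonneg (hμ _ _) (hK _ _)) (hL _ _)

lemma sum_noisyLaw {μ : X → Y → ℝ} {K : X → X → ℝ} {L : Y → Y → ℝ}
    (hK : ∀ x, ∑ x', K x x' = 1) (hL : ∀ y, ∑ y', L y y' = 1) :
    ∑ x, ∑ y, noisyLaw μ K L x y = ∑ x, ∑ y, μ x y := by
  have h : ∀ x', ∑ y', noisyLaw μ K L x' y' = ∑ x, ∑ y, μ x y * K x x' := by
    intro x'
    simp only [noisyLaw]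
    rw [Finset.sum_comm]
    simp only [← Finset.mul_sum, hL, mul_one]
    exact Finset.sum_comm
  simp only [h]
  rw [Finset.sum_comm]
  refine Finset.sum_congr rfl fun x _ => ?_
  rw [Finset.sum_comm]
  simp only [← Finset.mul_sum, hK, mul_one]

-- The two noises act on different inputs and commute. Both orders are needed, because the gain of
-- one player's noise is bounded below only when it acts directly on the exact table.
omit [Fintype T] in
lemma noisyTable_eq (P : T → X → Y → ℝ) (K : X → X → ℝ) (L : Y → Y → ℝ) :
    noisyTable P K L = fun t x y => ∑ y', L y y' * ∑ x', K x x' * P t x' y' := by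
  ext t x y
  simp only [noisyTable, Finset.mul_sum]
  rw [Finset.sum_comm]
  simp only [mul_left_comm]

lemma noisyLaw_eq (μ : X → Y → ℝ) (K : X → X → ℝ) (L : Y → Y → ℝ) :
    noisyLaw μ K L = fun x' y' => ∑ x, (∑ y, μ x y * L y y') * K x x' := by
  ext x' y'
  simp only [noisyLaw, Finset.sum_mul]
  rw [Finset.sum_comm]
  simp only [mul_right_comm]

lemma sum_mul_nonneg_of_nonneg {ι : Type*} [Fintype ι] {u v : ι → ℝ} (hu : ∀ i, 0 ≤ u i)
    (hv : ∀ i, 0 ≤ v i) : 0 ≤ ∑ i, u i * v i :=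
  Finset.sum_nonneg fun i _ => mul_nonneg (hu i) (hv i)

lemma sum_mixture_eq_one {ι : Type*} [Fintype ι] {w : ι → ℝ} (hw : ∑ i, w i = 1)
    {p : T → ι → ℝ} (hp : ∀ i, ∑ t, p t i = 1) : ∑ t, ∑ i, w i * p t i = 1 := by
  rw [Finset.sum_comm]
  simp only [← Finset.mul_sum, hp, mul_one, hw]

/-- Noise on both sides lowers the information cost of an exact protocol. -/
lemma tableCost_noisyTable_add_le {μ : X → Y → ℝ} {K : X → X → ℝ} {L : Y → Y → ℝ}
    {P : T → X → Y → ℝ} {f : X → Y → Z} {out : T → Z} {g : X → X} {k : Y → Y} {e a : ℝ}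
    (hμ : ∀ x y, 0 ≤ μ x y) (hK : IsNoise K g e a) (hL : IsNoise L k e a)
    (ha : 0 ≤ a) (hae : a ≤ 1 - e) (he : e ≤ 1 / 2)
    (hg : ∀ x y, f (g x) y = f x y) (hk : ∀ x y, f x (k y) = f x y)
    (hP : ∀ t x y, 0 ≤ P t x y) (hP1 : ∀ x y, ∑ t, P t x y = 1)
    (hf : ∀ t x y, P t x y ≠ 0 → out t = f x y) (ha1 : a ≤ 1) :
    tableCost μ (noisyTable P K L) + binEntropy a / 4 * ∑ x, ∑ y, μ x y *
        (sensitiveLeft f x y + sensitiveLeft (fun y x => f x y) y x)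
      ≤ tableCost (noisyLaw μ K L) P := by
  have hb : 0 ≤ binEntropy a := binEntropy_nonneg ha ha1
  have hμK : ∀ x' y, 0 ≤ ∑ x, μ x y * K x x' := fun x' y =>
    sum_mul_nonneg_of_nonneg (fun x => hμ x y) (fun x => hK.nonneg x x')
  have hμL : ∀ x y', 0 ≤ ∑ y, μ x y * L y y' := fun x y' =>
    sum_mul_nonneg_of_nonneg (hμ x) (fun y => hL.nonneg y y')
  have hPK : ∀ t x y, 0 ≤ ∑ x', K x x' * P t x' y := fun t x y =>
    sum_mul_nonneg_of_nonneg (hK.nonneg x) (fun x' => hP t x' y)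
  have hPL : ∀ t x y, 0 ≤ ∑ y', L y y' * P t x y' := fun t x y =>
    sum_mul_nonneg_of_nonneg (hL.nonneg y) (hP t x)
  have hPK1 : ∀ x y, ∑ t, ∑ x', K x x' * P t x' y = 1 := fun x y =>
    sum_mixture_eq_one (hK.sum_eq_one x) fun x' => hP1 x' y
  have hPL1 : ∀ x y, ∑ t, ∑ y', L y y' * P t x y' = 1 := fun x y =>
    sum_mixture_eq_one (hL.sum_eq_one y) fun y' => hP1 x y'
  -- The facts `a1` to `a5` keep only Bob's gain, and `b1` to `b5` only Alice's. Averaging the two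
  -- estimates costs a factor 1/2, and the passage from the half-noised law back to `μ` costs `1 - e
  -- ≥ 1/2`; hence the constant 1/4.
  have a1 := tableCost_noise_add_le hμ hK.nonneg hPL hPL1
  have a2 := noiseGain_nonneg hμ hK.nonneg hPL
  have a3 := tableCost_noise_right_add_le hμK hL.nonneg hP hP1
  have a4 := le_noiseGain (μ := fun y x' => ∑ x, μ x y * K x x') (f := fun y x => f x y)
    (P := fun t y x => P t x y) (fun y x => hμK x y) hL ha hae (fun y x => hk x y)
    (fun t y x => hP t x y) (fun y x => hP1 x y) (fun t y x => hf t x y)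
  have a5 := le_sum_noise_mul_sensitiveLeft (μ := fun y x => μ x y) (f := fun y x => f x y)
    (fun y x => hμ x y) hK (fun y x => hg x y)
  have b1 := tableCost_noise_right_add_le hμ hL.nonneg hPK hPK1
  have b2 := noiseGain_nonneg (μ := fun y x => μ x y)
    (P := fun t y x => ∑ x', K x x' * P t x' y) (fun y x => hμ x y) hL.nonneg
    (fun t y x => hPK t x y)
  have b3 := tableCost_noise_add_le hμL hK.nonneg hP hP1
  have b4 := le_noiseGain hμL hK ha hae hg hP hP1 hf
  have b5 := le_sum_noise_mul_sensitiveLeft hμ hL hk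
  have hs1 : 0 ≤ ∑ x, ∑ y, μ x y * sensitiveLeft f x y := Finset.sum_nonneg fun x _ =>
    sum_mul_nonneg_of_nonneg (hμ x) (sensitiveLeft_nonneg f x)
  have hs2 : 0 ≤ ∑ y, ∑ x, μ x y * sensitiveLeft (fun y x => f x y) y x :=
    Finset.sum_nonneg fun y _ =>
      sum_mul_nonneg_of_nonneg (fun x => hμ x y) (sensitiveLeft_nonneg _ y)
  rw [← noisyLaw_eq] at b3
  rw [← noisyTable_eq] at b1
  change tableCost μ (noisyTable P K L) + _ ≤ _ at a1
  change _ ≤ tableCost (noisyLaw μ K L) P at a3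
  have hsum : ∑ x, ∑ y, μ x y * (sensitiveLeft f x y + sensitiveLeft (fun y x => f x y) y x)
      = ∑ x, ∑ y, μ x y * sensitiveLeft f x y
        + ∑ y, ∑ x, μ x y * sensitiveLeft (fun y x => f x y) y x := by
    rw [Finset.sum_comm (γ := Y) (f := fun y x => μ x y * sensitiveLeft (fun y x => f x y) y x)]
    simp only [mul_add, Finset.sum_add_distrib]
  rw [hsum]
  set s1 := ∑ x, ∑ y, μ x y * sensitiveLeft f x y
  set s2 := ∑ y, ∑ x, μ x y * sensitiveLeft (fun y x => f x y) y x
  have a6 := mul_le_mul_of_nonneg_left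
    ((mul_le_mul_of_nonneg_right (show 1 / 2 ≤ 1 - e by linarith) hs2).trans a5) hb
  have b6 := mul_le_mul_of_nonneg_left
    ((mul_le_mul_of_nonneg_right (show 1 / 2 ≤ 1 - e by linarith) hs1).trans b5) hb
  linarith

end Gain

/-! ### Transcript laws, private simulation, and existence of exact protocols. -/

namespace Protocol

variable {X Y Z : Type*}

lemma prob_nonneg (π : Protocol X Y Z) (x : X) (y : Y) (t : π.Transcript) : 0 ≤ π.prob x y t := by
  induction π with
  | leaf z => exact zero_le_one
  | alice p π₀ π₁ h₀ h₁ =>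
    rcases t with t | t
    · exact mul_nonneg (sub_nonneg.2 (p x).2.2) (h₀ t)
    · exact mul_nonneg (p x).2.1 (h₁ t)
  | bob p π₀ π₁ h₀ h₁ =>
    rcases t with t | t
    · exact mul_nonneg (sub_nonneg.2 (p y).2.2) (h₀ t)
    · exact mul_nonneg (p y).2.1 (h₁ t)
  | coin q π₀ π₁ h₀ h₁ =>
    rcases t with t | t
    · exact mul_nonneg (sub_nonneg.2 q.2.2) (h₀ t)
    · exact mul_nonneg q.2.1 (h₁ t)

lemma sum_transcript_alice {M : Type*} [AddCommMonoid M] (p : X → unitInterval)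
    (π₀ π₁ : Protocol X Y Z) (F : (alice p π₀ π₁).Transcript → M) :
    ∑ t, F t = ∑ t : π₀.Transcript, F (Sum.inl t) + ∑ t : π₁.Transcript, F (Sum.inr t) :=
  Fintype.sum_sum_type F

lemma sum_transcript_bob {M : Type*} [AddCommMonoid M] (p : Y → unitInterval)
    (π₀ π₁ : Protocol X Y Z) (F : (bob p π₀ π₁).Transcript → M) :
    ∑ t, F t = ∑ t : π₀.Transcript, F (Sum.inl t) + ∑ t : π₁.Transcript, F (Sum.inr t) :=
  Fintype.sum_sum_type F

lemma sum_transcript_coin {M : Type*} [AddCommMonoid M] (q : unitInterval)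
    (π₀ π₁ : Protocol X Y Z) (F : (coin q π₀ π₁).Transcript → M) :
    ∑ t, F t = ∑ t : π₀.Transcript, F (Sum.inl t) + ∑ t : π₁.Transcript, F (Sum.inr t) :=
  Fintype.sum_sum_type F

lemma sum_transcript_leaf {M : Type*} [AddCommMonoid M] (z : Z)
    (F : (leaf z : Protocol X Y Z).Transcript → M) : ∑ t, F t = F () :=
  Fintype.sum_unique (ι := Unit) F

lemma sum_prob (π : Protocol X Y Z) (x : X) (y : Y) : ∑ t, π.prob x y t = 1 := by
  induction π with
  | leaf z => exact sum_transcript_leaf z _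
  | alice p π₀ π₁ h₀ h₁ =>
    rw [sum_transcript_alice]; simp only [prob, ← Finset.mul_sum, h₀, h₁]; ring
  | bob p π₀ π₁ h₀ h₁ =>
    rw [sum_transcript_bob]; simp only [prob, ← Finset.mul_sum, h₀, h₁]; ring
  | coin q π₀ π₁ h₀ h₁ =>
    rw [sum_transcript_coin]; simp only [prob, ← Finset.mul_sum, h₀, h₁]; ring

lemma weightedMean_mem_unitInterval {ι : Type*} [Fintype ι] {w : ι → ℝ} (hw : ∀ i, 0 ≤ w i)
    (p : ι → unitInterval) : (∑ i, w i * (p i : ℝ)) / ∑ i, w i ∈ unitInterval := by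
  have h0 : 0 ≤ ∑ i, w i * (p i : ℝ) :=
    Finset.sum_nonneg fun i _ => mul_nonneg (hw i) (p i).2.1
  refine ⟨div_nonneg h0 (Finset.sum_nonneg fun i _ => hw i), div_le_one_of_le₀ ?_
    (Finset.sum_nonneg fun i _ => hw i)⟩
  exact Finset.sum_le_sum fun i _ => mul_le_of_le_one_right (hw i) (p i).2.2

lemma sum_mul_weightedMean {ι : Type*} [Fintype ι] {w : ι → ℝ} (hw : ∀ i, 0 ≤ w i)
    (p : ι → unitInterval) :
    (∑ i, w i) * ((∑ i, w i * (p i : ℝ)) / ∑ i, w i) = ∑ i, w i * (p i : ℝ) := by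
  -- At total weight zero the quotient is 0 by convention; this is harmless because every weight
  -- then vanishes.
  rcases eq_or_ne (∑ i, w i) 0 with h | h
  · have : ∀ i, w i = 0 := fun i =>
      (Finset.sum_eq_zero_iff_of_nonneg fun i _ => hw i).1 h i (Finset.mem_univ i)
    simp [this]
  · field_simp

lemma sum_mul_one_sub_weightedMean {ι : Type*} [Fintype ι] {w : ι → ℝ} (hw : ∀ i, 0 ≤ w i)
    (p : ι → unitInterval) :
    (∑ i, w i) * (1 - (∑ i, w i * (p i : ℝ)) / ∑ i, w i) = ∑ i, w i * (1 - (p i : ℝ)) := by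
  rw [mul_sub, mul_one, sum_mul_weightedMean hw p]
  simp only [mul_sub, mul_one, Finset.sum_sub_distrib]

/-- The players can simulate, with private randomness only, the protocol `π` on privately
randomized inputs. The weights need not be normalized. -/
lemma exists_simulation [Fintype X] [Fintype Y] (π : Protocol X Y Z) :
    ∀ (w : X → X → ℝ) (v : Y → Y → ℝ), (∀ x x', 0 ≤ w x x') → (∀ y y', 0 ≤ v y y') →
    ∃ (σ : Protocol X Y Z) (e : σ.Transcript ≃ π.Transcript),
      (∀ t, σ.output t = π.output (e t)) ∧
      ∀ x y t, (∑ x', w x x') * (∑ y', v y y') * σ.prob x y t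
        = ∑ x', w x x' * ∑ y', v y y' * π.prob x' y' (e t) := by
  induction π with
  | leaf z =>
    intro w v _ _
    refine ⟨leaf z, Equiv.refl _, fun _ => rfl, fun x y t => ?_⟩
    simp only [prob, mul_one, Finset.sum_mul]
  | alice p π₀ π₁ h₀ h₁ =>
    intro w v hw hv
    -- Bayesian update: Alice's bit multiplies her weights by its likelihood and leaves Bob's alone,
    -- so the posterior remains a product.
    obtain ⟨σ₀, e₀, o₀, p₀⟩ := h₀ (fun x x' => w x x' * (1 - (p x' : ℝ))) v
      (fun x x' => mul_nonneg (hw x x') (sub_nonneg.2 (p x').2.2)) hv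
    obtain ⟨σ₁, e₁, o₁, p₁⟩ := h₁ (fun x x' => w x x' * (p x' : ℝ)) v
      (fun x x' => mul_nonneg (hw x x') (p x').2.1) hv
    refine ⟨alice (fun x => ⟨_, weightedMean_mem_unitInterval (hw x) p⟩) σ₀ σ₁,
      Equiv.sumCongr e₀ e₁, ?_, ?_⟩
    · rintro (t | t)
      · exact o₀ t
      · exact o₁ t
    · rintro x y (t | t)
      · have := p₀ x y t
        rw [← sum_mul_one_sub_weightedMean (hw x) p] at this
        change (∑ x', w x x') * (∑ y', v y y') * ((1 - (∑ i, w x i * (p i : ℝ)) / ∑ i, w x i) * σ₀.prob x y t)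
          = ∑ x', w x x' * ∑ y', v y y' * ((1 - (p x' : ℝ)) * π₀.prob x' y' (e₀ t))
        calc _ = _ := by ring
          _ = _ := this
          _ = _ := by simp only [Finset.mul_sum]; congr! 2; ring
      · have := p₁ x y t
        rw [← sum_mul_weightedMean (hw x) p] at this
        change (∑ x', w x x') * (∑ y', v y y') * (((∑ i, w x i * (p i : ℝ)) / ∑ i, w x i) * σ₁.prob x y t)
          = ∑ x', w x x' * ∑ y', v y y' * ((p x' : ℝ) * π₁.prob x' y' (e₁ t))
        calc _ = _ := by ring
          _ = _ := this
          _ = _ := by simp only [Finset.mul_sum]; congr! 2; ring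
  | bob p π₀ π₁ h₀ h₁ =>
    intro w v hw hv
    obtain ⟨σ₀, e₀, o₀, p₀⟩ := h₀ w (fun y y' => v y y' * (1 - (p y' : ℝ))) hw
      (fun y y' => mul_nonneg (hv y y') (sub_nonneg.2 (p y').2.2))
    obtain ⟨σ₁, e₁, o₁, p₁⟩ := h₁ w (fun y y' => v y y' * (p y' : ℝ)) hw
      (fun y y' => mul_nonneg (hv y y') (p y').2.1)
    refine ⟨bob (fun y => ⟨_, weightedMean_mem_unitInterval (hv y) p⟩) σ₀ σ₁,
      Equiv.sumCongr e₀ e₁, ?_, ?_⟩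
    · rintro (t | t)
      · exact o₀ t
      · exact o₁ t
    · rintro x y (t | t)
      · have := p₀ x y t
        rw [← sum_mul_one_sub_weightedMean (hv y) p] at this
        change (∑ x', w x x') * (∑ y', v y y') * ((1 - (∑ i, v y i * (p i : ℝ)) / ∑ i, v y i) * σ₀.prob x y t)
          = ∑ x', w x x' * ∑ y', v y y' * ((1 - (p y' : ℝ)) * π₀.prob x' y' (e₀ t))
        calc _ = _ := by ring
          _ = _ := this
          _ = _ := by simp only [Finset.mul_sum]; congr! 2; ring
      · have := p₁ x y t
        rw [← sum_mul_weightedMean (hv y) p] at this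
        change (∑ x', w x x') * (∑ y', v y y') * (((∑ i, v y i * (p i : ℝ)) / ∑ i, v y i) * σ₁.prob x y t)
          = ∑ x', w x x' * ∑ y', v y y' * ((p y' : ℝ) * π₁.prob x' y' (e₁ t))
        calc _ = _ := by ring
          _ = _ := this
          _ = _ := by simp only [Finset.mul_sum]; congr! 2; ring
  | coin q π₀ π₁ h₀ h₁ =>
    intro w v hw hv
    obtain ⟨σ₀, e₀, o₀, p₀⟩ := h₀ w v hw hv
    obtain ⟨σ₁, e₁, o₁, p₁⟩ := h₁ w v hw hv
    refine ⟨coin q σ₀ σ₁, Equiv.sumCongr e₀ e₁, ?_, ?_⟩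
    · rintro (t | t)
      · exact o₀ t
      · exact o₁ t
    · rintro x y (t | t)
      · change (∑ x', w x x') * (∑ y', v y y') * ((1 - (q : ℝ)) * σ₀.prob x y t)
          = ∑ x', w x x' * ∑ y', v y y' * ((1 - (q : ℝ)) * π₀.prob x' y' (e₀ t))
        rw [mul_left_comm, p₀ x y t]
        simp only [Finset.mul_sum]; congr! 2; ring
      · change (∑ x', w x x') * (∑ y', v y y') * ((q : ℝ) * σ₁.prob x y t)
          = ∑ x', w x x' * ∑ y', v y y' * ((q : ℝ) * π₁.prob x' y' (e₁ t))
        rw [mul_left_comm, p₁ x y t]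
        simp only [Finset.mul_sum]; congr! 2; ring

lemma errorProb_alice (p : X → unitInterval) (π₀ π₁ : Protocol X Y Z) (f : X × Y → Z) (x : X)
    (y : Y) : (alice p π₀ π₁).errorProb f x y
      = (1 - (p x : ℝ)) * π₀.errorProb f x y + (p x : ℝ) * π₁.errorProb f x y := by
  simp only [errorProb, sum_transcript_alice, output, prob, Finset.mul_sum, mul_ite, mul_zero]
  rfl

lemma errorProb_bob (p : Y → unitInterval) (π₀ π₁ : Protocol X Y Z) (f : X × Y → Z) (x : X)
    (y : Y) : (bob p π₀ π₁).errorProb f x y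
      = (1 - (p y : ℝ)) * π₀.errorProb f x y + (p y : ℝ) * π₁.errorProb f x y := by
  simp only [errorProb, sum_transcript_bob, output, prob, Finset.mul_sum, mul_ite, mul_zero]
  rfl

lemma errorProb_leaf (f : X × Y → Z) (x : X) (y : Y) :
    (leaf (f (x, y)) : Protocol X Y Z).errorProb f x y = 0 := by
  simp only [errorProb, sum_transcript_leaf, output, ne_eq, not_true_eq_false, if_false]

open Classical in
/-- Every function is computed without error by some protocol. -/
lemma exists_performs_zero [Fintype X] [Fintype Y] [Nonempty X] [Nonempty Y] (f : X × Y → Z) :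
    ∃ π : Protocol X Y Z, π.Performs f 0 := by
  have hbob : ∀ x, ∀ s : Finset Y, ∃ π : Protocol X Y Z, ∀ y ∈ s, π.errorProb f x y = 0 := by
    intro x s
    induction s using Finset.induction_on with
    | empty => exact ⟨leaf (f (x, Classical.arbitrary Y)), by simp⟩
    | insert b s hb ih =>
      obtain ⟨π, hπ⟩ := ih
      refine ⟨bob (fun y => if y = b then 1 else 0) π (leaf (f (x, b))), fun y hy => ?_⟩
      rw [errorProb_bob]
      by_cases h : y = b
      · subst h; simp [errorProb_leaf]
      · simp [h, hπ y (Finset.mem_of_mem_insert_of_ne hy h)]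
  have halice : ∀ s : Finset X, ∃ π : Protocol X Y Z, ∀ x ∈ s, ∀ y, π.errorProb f x y = 0 := by
    intro s
    induction s using Finset.induction_on with
    | empty => exact ⟨leaf (f (Classical.arbitrary X, Classical.arbitrary Y)), by simp⟩
    | insert b s hb ih =>
      obtain ⟨π, hπ⟩ := ih
      obtain ⟨π', hπ'⟩ := hbob b Finset.univ
      refine ⟨alice (fun x => if x = b then 1 else 0) π π', fun x hx y => ?_⟩
      rw [errorProb_alice]
      by_cases h : x = b
      · subst h; simp [hπ' y (Finset.mem_univ y)]
      · simp [h, hπ x (Finset.mem_of_mem_insert_of_ne hx h)]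
  obtain ⟨π, hπ⟩ := halice Finset.univ
  exact ⟨π, fun x y => (hπ x (Finset.mem_univ x) y).le⟩

end Protocol


/-! ### Merging the insensitive inputs, and concentration of the noisy law. -/

section Merging

variable {X Y Z : Type*} [Fintype X] [Fintype Y]

lemma mul_binEntropy_le {t x : ℝ} (ht : 0 ≤ t) (ht1 : t ≤ 1) (hx : 0 ≤ x) (hx1 : x ≤ 1) :
    t * Real.binEntropy x ≤ Real.binEntropy (t * x) := by
  have := Real.strictConcave_binEntropy.concaveOn.2 (x := x) ⟨hx, hx1⟩ (y := 0)
    ⟨le_rfl, zero_le_one⟩ ht (sub_nonneg.2 ht1) (by ring)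
  simpa using this

lemma h_nonneg {x : ℝ} (hx : 0 ≤ x) (hx1 : x ≤ 1) : 0 ≤ h x :=
  div_nonneg (Real.binEntropy_nonneg hx hx1) (Real.log_nonneg one_le_two)

lemma h_le_one (x : ℝ) : h x ≤ 1 :=
  div_le_one_of_le₀ Real.binEntropy_le_log_two (Real.log_nonneg one_le_two)

lemma mul_h_le {t x : ℝ} (ht : 0 ≤ t) (ht1 : t ≤ 1) (hx : 0 ≤ x) (hx1 : x ≤ 1) :
    t * h x ≤ h (t * x) := by
  rw [h, h, ← mul_div_assoc]
  exact div_le_div_of_nonneg_right (mul_binEntropy_le ht ht1 hx hx1)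
    (Real.log_nonneg one_le_two)

/-- The inputs which are not sensitive for either player can be merged into a single input. -/
lemma exists_merge [Nonempty X] [Nonempty Y] (f : X → Y → Z) :
    ∃ (g : X → X) (k : Y → Y) (x₀ : X) (y₀ : Y), (∀ x y, f (g x) y = f x y) ∧
      (∀ x y, f x (k y) = f x y) ∧
      ∀ x y, sensitiveLeft f x y + sensitiveLeft (fun y x => f x y) y x < 1 →
        g x = x₀ ∧ k y = y₀ := by
  classical
  have hins : ∀ x y, sensitiveLeft f x y + sensitiveLeft (fun y x => f x y) y x < 1 →
      (∀ x', f x' y = f x y) ∧ ∀ y', f x y' = f x y := by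
    intro x y hlt
    have h1 := sensitiveLeft_nonneg f x y
    have h2 := sensitiveLeft_nonneg (fun y x => f x y) y x
    constructor
    · by_contra! hne
      have : sensitiveLeft f x y = 1 := if_pos hne
      linarith
    · by_contra! hne
      have : sensitiveLeft (fun y x => f x y) y x = 1 := if_pos hne
      linarith
  by_cases hex : ∃ x y, sensitiveLeft f x y + sensitiveLeft (fun y x => f x y) y x < 1
  · obtain ⟨x₀, y₀, h₀⟩ := hex
    obtain ⟨hc, hr⟩ := hins x₀ y₀ h₀
    -- Collapse every row, and every column, on which `f` is constantly `f x₀ y₀`. An insensitive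
    -- pair lies on a constant row and a constant column; these cross the row and column of `(x₀,
    -- y₀)`, which forces the same value.
    refine ⟨fun x => if ∀ y', f x y' = f x₀ y₀ then x₀ else x,
      fun y => if ∀ x', f x' y = f x₀ y₀ then y₀ else y, x₀, y₀, fun x y => ?_, fun x y => ?_,
      fun x y hxy => ?_⟩
    · dsimp only
      split_ifs with hx
      · rw [hx y, hr y]
      · rfl
    · dsimp only
      split_ifs with hy
      · rw [hy x, hc x]
      · rfl
    · obtain ⟨hc', hr'⟩ := hins x y hxy
      have hv : f x y = f x₀ y₀ := by rw [← hr' y₀, hc x]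
      exact ⟨if_pos fun y' => (hr' y').trans hv, if_pos fun x' => (hc' x').trans hv⟩
  · exact ⟨id, id, Classical.arbitrary X, Classical.arbitrary Y, fun _ _ => rfl, fun _ _ => rfl,
      fun x y hxy => (hex ⟨x, y, hxy⟩).elim⟩

/-- Each pair with `s x y < 1` reaches `(x₀, y₀)` with probability at least `(1 - e) ^ 2`; for the
other pairs `1 - s x y` is nonpositive, so they can be included in the sum. -/
lemma le_noisyLaw {μ : X → Y → ℝ} {K : X → X → ℝ} {L : Y → Y → ℝ} {g : X → X} {k : Y → Y}
    {e a : ℝ} {x₀ : X} {y₀ : Y} {s : X → Y → ℝ} (hμ : ∀ x y, 0 ≤ μ x y)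
    (hμ1 : ∑ x, ∑ y, μ x y = 1) (hK : IsNoise K g e a)
    (hL : IsNoise L k e a) (he : 0 ≤ e) (he1 : e ≤ 1 / 2) (hs : ∀ x y, 0 ≤ s x y)
    (hgk : ∀ x y, s x y < 1 → g x = x₀ ∧ k y = y₀) :
    1 - 2 * e - ∑ x, ∑ y, μ x y * s x y ≤ noisyLaw μ K L x₀ y₀ := by
  have key : ∀ x y, (1 - e) ^ 2 * (μ x y - μ x y * s x y) ≤ μ x y * K x x₀ * L y y₀ := by
    intro x y
    have h0 : 0 ≤ μ x y * K x x₀ * L y y₀ :=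
      mul_nonneg (mul_nonneg (hμ x y) (hK.nonneg x x₀)) (hL.nonneg y y₀)
    rcases lt_or_ge (s x y) 1 with hlt | hge
    · obtain ⟨rfl, rfl⟩ := hgk x y hlt
      have h1 : (1 - e) * (1 - e) ≤ K x (g x) * L y (k y) :=
        mul_le_mul (hK.one_sub_le x) (hL.one_sub_le y) (by linarith) (hK.nonneg _ _)
      have h2 := mul_le_mul_of_nonneg_left h1 (hμ x y)
      have h3 := mul_nonneg (sq_nonneg (1 - e)) (mul_nonneg (hμ x y) (hs x y))
      linarith
    · have h1 : μ x y - μ x y * s x y ≤ 0 := by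
        have := mul_le_mul_of_nonneg_left hge (hμ x y)
        linarith
      exact (mul_nonpos_of_nonneg_of_nonpos (sq_nonneg _) h1).trans h0
  have hsum : (1 - e) ^ 2 * (1 - ∑ x, ∑ y, μ x y * s x y) ≤ noisyLaw μ K L x₀ y₀ := by
    calc (1 - e) ^ 2 * (1 - ∑ x, ∑ y, μ x y * s x y)
        = ∑ x, ∑ y, (1 - e) ^ 2 * (μ x y - μ x y * s x y) := by
          rw [← hμ1]
          simp only [← Finset.mul_sum, Finset.sum_sub_distrib]
      _ ≤ ∑ x, ∑ y, μ x y * K x x₀ * L y y₀ :=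
          Finset.sum_le_sum fun x _ => Finset.sum_le_sum fun y _ => key x y
      _ = noisyLaw μ K L x₀ y₀ := by
          simp only [noisyLaw, Finset.sum_mul]
          exact Finset.sum_comm
  have hS : 0 ≤ ∑ x, ∑ y, μ x y * s x y :=
    Finset.sum_nonneg fun x _ => sum_mul_nonneg_of_nonneg (hμ x) (hs x)
  rcases le_total (∑ x, ∑ y, μ x y * s x y) 1 with hle | hge
  · nlinarith [mul_nonneg he hS, mul_nonneg (sq_nonneg e) (sub_nonneg.2 hle)]
  · have := noisyLaw_nonneg hμ hK.nonneg hL.nonneg x₀ y₀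
    linarith

/-- Continuity of the input entropy at a point mass, where it vanishes. -/
lemma exists_inputEntropy_le (x₀ : X) (y₀ : Y) {κ : ℝ} (hκ : 0 < κ) :
    ∃ η > 0, ∀ ν : X → Y → ℝ, (∀ x y, 0 ≤ ν x y) → ∑ x, ∑ y, ν x y = 1 →
      1 - η ≤ ν x₀ y₀ → inputEntropy ν ≤ κ := by
  classical
  set δ : X → Y → ℝ := fun x y => if x = x₀ then if y = y₀ then 1 else 0 else 0 with hδ
  have hδ0 : inputEntropy δ = 0 := by
    have h1 : ∀ y, ∑ x, δ x y = if y = y₀ then 1 else 0 := by intro y; simp [hδ]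
    have h2 : ∀ x, ∑ y, δ x y = if x = x₀ then 1 else 0 := by
      intro x; by_cases hx : x = x₀ <;> simp [hδ, hx]
    have h3 : ∀ x y, Real.negMulLog (δ x y) = 0 := by
      intro x y; simp only [hδ]; split_ifs <;> simp
    simp only [inputEntropy, homEntropy, h1, h2, h3]
    simp [apply_ite Real.negMulLog]
  obtain ⟨η, hη, hball⟩ := Metric.continuous_iff.1 (continuous_inputEntropy (X := X) (Y := Y))
    δ κ hκ
  refine ⟨η / 2, half_pos hη, fun ν hν hν1 hpt => ?_⟩
  have hrow : ∀ x, 0 ≤ ∑ y, ν x y := fun x => Finset.sum_nonneg fun y _ => hν x y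
  have hle : ∀ x y, ¬ (x = x₀ ∧ y = y₀) → ν x y ≤ η / 2 := by
    intro x y hne
    have hprod : ∑ p : X × Y, ν p.1 p.2 = 1 := by rw [Fintype.sum_prod_type, hν1]
    have hpair : ∑ p ∈ {(x, y), (x₀, y₀)}, ν p.1 p.2 ≤ ∑ p : X × Y, ν p.1 p.2 :=
      Finset.sum_le_sum_of_subset_of_nonneg (Finset.subset_univ _) fun p _ _ => hν p.1 p.2
    rw [Finset.sum_pair (fun heq => hne (Prod.mk.inj heq)), hprod] at hpair
    dsimp only at hpair
    linarith
  have hle1 : ν x₀ y₀ ≤ 1 := by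
    rw [← hν1]
    exact (Finset.single_le_sum (fun y _ => hν x₀ y) (Finset.mem_univ y₀)).trans
      (Finset.single_le_sum (fun x _ => hrow x) (Finset.mem_univ x₀))
  have hdist : dist ν δ < η := by
    refine lt_of_le_of_lt ?_ (half_lt_self hη)
    refine (dist_pi_le_iff (half_pos hη).le).2 fun x => (dist_pi_le_iff (half_pos hη).le).2
      fun y => ?_
    rw [Real.dist_eq, abs_le]
    by_cases hxy : x = x₀ ∧ y = y₀
    · obtain ⟨rfl, rfl⟩ := hxy
      simp only [hδ, if_true]
      constructor <;> linarith
    · have h0 : δ x y = 0 := by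
        simp only [hδ]
        split_ifs with h1 h2
        · exact (hxy ⟨h1, h2⟩).elim
        · rfl
        · rfl
      have := hle x y hxy
      have := hν x y
      rw [h0]
      constructor <;> linarith
  have := hball ν hdist
  rw [hδ0, Real.dist_eq, sub_zero] at this
  exact (le_abs_self _).trans this.le

end Merging

/-! ### Cost bounds for protocols and the noisy protocol. -/

namespace Protocol

variable {X Y Z : Type*} [Fintype X] [Fintype Y]

lemma infoCost_eq (μ : X × Y → ℝ) (π : Protocol X Y Z) :
    infoCost μ π
      = tableCost (fun x y => μ (x, y)) (fun t x y => π.prob x y t) / Real.log 2 := by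
  rw [infoCost, condMutualInfo_eq, condMutualInfo_eq, ← add_div]
  rfl

lemma infoCost_nonneg {μ : X × Y → ℝ} (hμ : ∀ p, 0 ≤ μ p) (π : Protocol X Y Z) :
    0 ≤ infoCost μ π := by
  rw [infoCost_eq]
  exact div_nonneg (tableCost_nonneg (fun x y => hμ _) fun t x y => π.prob_nonneg x y t)
    (Real.log_nonneg one_le_two)

lemma infoCost_le_inputEntropy {μ : X × Y → ℝ} (hμ : ∀ p, 0 ≤ μ p) (π : Protocol X Y Z) :
    infoCost μ π ≤ inputEntropy (fun x y => μ (x, y)) / Real.log 2 := by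
  rw [infoCost_eq]
  exact div_le_div_of_nonneg_right (tableCost_le_inputEntropy (fun x y => hμ _)
    (fun t x y => π.prob_nonneg x y t) fun x y => π.sum_prob x y) (Real.log_nonneg one_le_two)

/-- The input entropy is a continuous bound on a compact simplex. Boundedness is what makes the real
supremum an upper bound for the individual costs. -/
lemma bddAbove_infoCost (π : Protocol X Y Z) :
    BddAbove (Set.range fun μ : stdSimplex ℝ (X × Y) => infoCost (μ : X × Y → ℝ) π) := by
  have hcont : Continuous fun μ : X × Y → ℝ =>
      inputEntropy (fun x y => μ (x, y)) / Real.log 2 :=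
    (continuous_inputEntropy.comp (by fun_prop)).div_const _
  obtain ⟨C, hC⟩ := ((isCompact_stdSimplex ℝ (X × Y)).image hcont).bddAbove
  refine ⟨C, ?_⟩
  rintro _ ⟨μ, rfl⟩
  exact (infoCost_le_inputEntropy μ.2.1 π).trans (hC ⟨μ, μ.2, rfl⟩)

lemma infoCost_le_maxInfoCost (π : Protocol X Y Z) {μ : X × Y → ℝ}
    (hμ : μ ∈ stdSimplex ℝ (X × Y)) : infoCost μ π ≤ π.maxInfoCost :=
  le_ciSup π.bddAbove_infoCost ⟨μ, hμ⟩

lemma maxInfoCost_nonneg (π : Protocol X Y Z) : 0 ≤ π.maxInfoCost :=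
  Real.iSup_nonneg fun μ => infoCost_nonneg μ.2.1 π

omit [Fintype X] [Fintype Y] in
lemma output_eq_of_performs_zero {π : Protocol X Y Z} {f : X × Y → Z} (hπ : π.Performs f 0)
    {x : X} {y : Y} {t : π.Transcript} (ht : π.prob x y t ≠ 0) : π.output t = f (x, y) := by
  classical
  by_contra hne
  have hle := Finset.single_le_sum (s := Finset.univ)
    (f := fun t => if π.output t ≠ f (x, y) then π.prob x y t else 0)
    (fun t _ => by split_ifs <;> first | exact π.prob_nonneg x y t | exact le_rfl)
    (Finset.mem_univ t)
  simp only [ne_eq, hne, not_false_eq_true, if_true] at hle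
  have h1 : π.prob x y t ≤ π.errorProb f x y := by
    refine hle.trans_eq ?_
    unfold errorProb
    congr! 1
  exact ht (le_antisymm (h1.trans (hπ x y)) (π.prob_nonneg x y t))

omit [Fintype X] [Fintype Y] in
open Classical in
lemma errorProb_eq (π : Protocol X Y Z) (f : X × Y → Z) (x : X) (y : Y) :
    π.errorProb f x y = 1 - ∑ t, if π.output t = f (x, y) then π.prob x y t else 0 := by
  rw [← π.sum_prob x y, ← Finset.sum_sub_distrib, errorProb]
  refine Finset.sum_congr rfl fun t _ => ?_
  by_cases ht : π.output t = f (x, y) <;> simp [ht]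

/-- Running an exact protocol on noisy inputs. -/
lemma exists_noisy_protocol {π : Protocol X Y Z} {f : X × Y → Z} (hπ : π.Performs f 0)
    {K : X → X → ℝ} {L : Y → Y → ℝ} {g : X → X} {k : Y → Y} {e a : ℝ} (hK : IsNoise K g e a)
    (hL : IsNoise L k e a) (he1 : e ≤ 1) (hg : ∀ x y, f (g x, y) = f (x, y))
    (hk : ∀ x y, f (x, k y) = f (x, y)) :
    ∃ σ : Protocol X Y Z, σ.Performs f (2 * e) ∧ ∀ μ : X × Y → ℝ, infoCost μ σ
      = tableCost (fun x y => μ (x, y)) (noisyTable (fun t x y => π.prob x y t) K L)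
        / Real.log 2 := by
  classical
  obtain ⟨σ, E, hout, hprob⟩ := π.exists_simulation K L hK.nonneg hL.nonneg
  have hσ : ∀ x y t, σ.prob x y t = noisyTable (fun t x y => π.prob x y t) K L (E t) x y := by
    intro x y t
    have := hprob x y t
    rwa [hK.sum_eq_one, hL.sum_eq_one, one_mul, one_mul] at this
  refine ⟨σ, fun x y => ?_, fun μ => ?_⟩
  · have hlow : ∀ t, K x (g x) * L y (k y) * π.prob (g x) (k y) (E t)
        ≤ if σ.output t = f (x, y) then σ.prob x y t else 0 := by
      intro t
      split_ifs with ht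
      · rw [hσ]
        have h1 := Finset.single_le_sum (s := Finset.univ)
          (f := fun y' => L y y' * π.prob (g x) y' (E t))
          (fun y' _ => mul_nonneg (hL.nonneg y y') (π.prob_nonneg _ _ _)) (Finset.mem_univ (k y))
        have h2 := Finset.single_le_sum (s := Finset.univ)
          (f := fun x' => K x x' * ∑ y', L y y' * π.prob x' y' (E t))
          (fun x' _ => mul_nonneg (hK.nonneg x x') (sum_mul_nonneg_of_nonneg (hL.nonneg y)
            fun y' => π.prob_nonneg _ _ _)) (Finset.mem_univ (g x))
        rw [mul_assoc]
        exact (mul_le_mul_of_nonneg_left h1 (hK.nonneg _ _)).trans h2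
      · have : π.prob (g x) (k y) (E t) = 0 := by
          by_contra hne
          refine ht ?_
          rw [hout, output_eq_of_performs_zero hπ hne, hg, hk]
        rw [this, mul_zero]
    have hsum := Finset.sum_le_sum fun t (_ : t ∈ Finset.univ) => hlow t
    rw [← Finset.mul_sum, Equiv.sum_comp E (fun t => π.prob (g x) (k y) t), π.sum_prob,
      mul_one] at hsum
    have h1 : (1 - e) * (1 - e) ≤ K x (g x) * L y (k y) :=
      mul_le_mul (hK.one_sub_le x) (hL.one_sub_le y) (by linarith) (hK.nonneg _ _)
    rw [errorProb_eq]
    nlinarith [sq_nonneg e]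
  · rw [infoCost_eq, ← tableCost_comp_equiv E]
    simp only [hσ]

/-- The total weight of the sensitive inputs, counted once for each player to whom they are
sensitive. -/
noncomputable def sensitiveMass (f : X × Y → Z) (μ : X × Y → ℝ) : ℝ :=
  ∑ x, ∑ y, μ (x, y) * (sensitiveLeft (fun x y => f (x, y)) x y
    + sensitiveLeft (fun y x => f (x, y)) y x)

/-- From an exact protocol one obtains a noisy one which saves information on all input
distributions that have sensitive inputs, and which is run on inputs close to a fixed point
otherwise. -/
lemma exists_cheaper_protocol [Nonempty X] [Nonempty Y] (f : X × Y → Z) :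
    ∃ (x₀ : X) (y₀ : Y), ∀ (π : Protocol X Y Z), π.Performs f 0 → ∀ e : ℝ, 0 ≤ e → e ≤ 1 / 2 →
      ∃ σ : Protocol X Y Z, σ.Performs f (2 * e) ∧ ∀ μ ∈ stdSimplex ℝ (X × Y),
        ∃ ν ∈ stdSimplex ℝ (X × Y),
          infoCost μ σ + h e / (4 * (Fintype.card X + Fintype.card Y)) * sensitiveMass f μ
            ≤ infoCost ν π ∧ 1 - 2 * e - sensitiveMass f μ ≤ ν (x₀, y₀) := by
  obtain ⟨g, k, x₀, y₀, hg, hk, hgk⟩ := exists_merge fun x y => f (x, y)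
  refine ⟨x₀, y₀, fun π hπ e he he1 => ?_⟩
  have hX : (1 : ℝ) ≤ Fintype.card X := Nat.one_le_cast.2 Fintype.card_pos
  have hY : (1 : ℝ) ≤ Fintype.card Y := Nat.one_le_cast.2 Fintype.card_pos
  set N : ℝ := Fintype.card X + Fintype.card Y with hN
  have hNpos : 0 < N := by linarith
  have hN1 : N⁻¹ ≤ 1 := inv_le_one_of_one_le₀ (by linarith)
  have ha : 0 ≤ N⁻¹ * e := by positivity
  have hae : N⁻¹ * e ≤ e := mul_le_of_le_one_left he hN1
  -- One lower bound `e / N` on the noise probabilities serves both players, since `N` dominates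
  -- both alphabet sizes.
  have hcard : ∀ m : ℝ, m ≤ N → N⁻¹ * e * m ≤ e := by
    intro m hm
    calc N⁻¹ * e * m ≤ N⁻¹ * e * N := mul_le_mul_of_nonneg_left hm ha
      _ = e := by field_simp
  obtain ⟨K, hK⟩ := exists_isNoise g he (by linarith) (hcard _ (by linarith))
  obtain ⟨L, hL⟩ := exists_isNoise k he (by linarith) (hcard _ (by linarith))
  obtain ⟨σ, hσ, hcost⟩ := exists_noisy_protocol hπ hK hL (by linarith) hg hk
  refine ⟨σ, hσ, fun μ hμ => ⟨fun p => noisyLaw (fun x y => μ (x, y)) K L p.1 p.2,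
    ⟨fun p => noisyLaw_nonneg (fun x y => hμ.1 _) hK.nonneg hL.nonneg _ _, ?_⟩, ?_, ?_⟩⟩
  · rw [Fintype.sum_prod_type, sum_noisyLaw hK.sum_eq_one hL.sum_eq_one,
      ← Fintype.sum_prod_type, hμ.2]
  · have hmain := tableCost_noisyTable_add_le (μ := fun x y => μ (x, y)) (out := π.output)
      (f := fun x y => f (x, y))
      (fun x y => hμ.1 _) hK hL ha (by linarith) he1 hg hk
      (fun t x y => π.prob_nonneg x y t) (fun x y => π.sum_prob x y)
      (fun t x y ht => output_eq_of_performs_zero hπ ht) (by linarith)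
    have hmass : 0 ≤ sensitiveMass f μ := Finset.sum_nonneg fun x _ =>
      sum_mul_nonneg_of_nonneg (fun y => hμ.1 _) fun y =>
        add_nonneg (sensitiveLeft_nonneg _ _ _) (sensitiveLeft_nonneg _ _ _)
    have hbin := mul_le_mul_of_nonneg_right
      (mul_binEntropy_le (by positivity) hN1 he (by linarith)) hmass
    have hlog : 0 < Real.log 2 := Real.log_pos one_lt_two
    rw [hcost, infoCost_eq, le_div_iff₀ hlog, add_mul, div_mul_cancel₀ _ hlog.ne']
    refine le_trans (add_le_add_right ?_ _) hmain
    change _ ≤ Real.binEntropy (N⁻¹ * e) / 4 * sensitiveMass f μ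
    calc h e / (4 * N) * sensitiveMass f μ * Real.log 2
        = N⁻¹ * Real.binEntropy e * sensitiveMass f μ / 4 := by rw [h]; field_simp
      _ ≤ Real.binEntropy (N⁻¹ * e) * sensitiveMass f μ / 4 := by linarith
      _ = _ := by ring
  · refine le_noisyLaw (fun x y => hμ.1 _) ?_ hK hL he he1
      (fun x y => add_nonneg (sensitiveLeft_nonneg _ _ _) (sensitiveLeft_nonneg _ _ _)) hgk
    rw [← Fintype.sum_prod_type, hμ.2]

end Protocol

/-! ### From single protocols to the information complexity. -/

section InformationComplexity

open Protocol

variable {X Y Z : Type*} [Fintype X] [Fintype Y]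

lemma bddBelow_maxInfoCost (f : X × Y → Z) (ε : ℝ) :
    BddBelow (Set.range fun π : {π : Protocol X Y Z // π.Performs f ε} => π.1.maxInfoCost) :=
  ⟨0, by rintro _ ⟨π, rfl⟩; exact π.1.maxInfoCost_nonneg⟩

lemma IC_le_maxInfoCost {f : X × Y → Z} {ε : ℝ} {π : Protocol X Y Z} (hπ : π.Performs f ε) :
    IC f ε ≤ π.maxInfoCost :=
  ciInf_le (bddBelow_maxInfoCost f ε) ⟨π, hπ⟩

lemma nonempty_performs [Nonempty X] [Nonempty Y] (f : X × Y → Z) {ε : ℝ} (hε : 0 ≤ ε) :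
    Nonempty {π : Protocol X Y Z // π.Performs f ε} := by
  obtain ⟨π, hπ⟩ := exists_performs_zero f
  exact ⟨⟨π, fun x y => (hπ x y).trans hε⟩⟩

lemma IC_anti [Nonempty X] [Nonempty Y] (f : X × Y → Z) {ε ε' : ℝ} (hε : 0 ≤ ε) (h : ε ≤ ε') :
    IC f ε' ≤ IC f ε := by
  have := nonempty_performs f hε
  exact le_ciInf fun π => IC_le_maxInfoCost fun x y => (π.2 x y).trans h

-- Move between two inputs of different value one coordinate at a time: one of the two moves changes
-- the value.
omit [Fintype X] [Fintype Y] in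
lemma exists_sensitive {f : X × Y → Z} (hf : ∃ a b, f a ≠ f b) :
    ∃ x y, 1 ≤ sensitiveLeft (fun x y => f (x, y)) x y
      + sensitiveLeft (fun y x => f (x, y)) y x := by
  obtain ⟨⟨x, y⟩, ⟨x', y'⟩, hne⟩ := hf
  by_cases h : f (x', y) = f (x, y)
  · refine ⟨x', y, ?_⟩
    have h1 : sensitiveLeft (fun y x => f (x, y)) y x' = 1 :=
      if_pos ⟨y', fun heq => hne (h.symm.trans heq.symm)⟩
    have h2 := sensitiveLeft_nonneg (fun x y => f (x, y)) x' y
    linarith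
  · refine ⟨x, y, ?_⟩
    have h1 : sensitiveLeft (fun x y => f (x, y)) x y = 1 := if_pos ⟨x', h⟩
    have h2 := sensitiveLeft_nonneg (fun y x => f (x, y)) y x
    linarith

lemma h_half : h (1 / 2) = 1 := by
  rw [h, one_div, Real.binEntropy_two_inv, div_self (Real.log_pos one_lt_two).ne']

/-- The exact information complexity of a non-constant function is positive. -/
lemma le_IC_zero [Nonempty X] [Nonempty Y] {f : X × Y → Z} (hf : ∃ a b, f a ≠ f b) :
    1 / (4 * ((Fintype.card X : ℝ) + Fintype.card Y)) ≤ IC f 0 := by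
  classical
  have := nonempty_performs f le_rfl
  refine le_ciInf fun π => ?_
  obtain ⟨x₀, y₀, hcheap⟩ := exists_cheaper_protocol f
  -- With `e = 1 / 2` the error guarantee is void, but the saving at a sensitive point mass is at
  -- least `1 / (4N)`, and a cost after saving is still nonnegative.
  obtain ⟨σ, -, hσ⟩ := hcheap π.1 π.2 (1 / 2) (by norm_num) le_rfl
  obtain ⟨x, y, hxy⟩ := exists_sensitive hf
  have hμ : Pi.single (x, y) 1 ∈ stdSimplex ℝ (X × Y) := single_mem_stdSimplex ℝ (x, y)
  obtain ⟨ν, hν, hle, -⟩ := hσ _ hμ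
  have hmass : 1 ≤ sensitiveMass f (Pi.single (x, y) 1) := by
    rw [sensitiveMass, ← Fintype.sum_prod_type (f := fun p : X × Y => (Pi.single (x, y) 1 : _ → ℝ) p
      * (sensitiveLeft (fun x y => f (x, y)) p.1 p.2
        + sensitiveLeft (fun y x => f (x, y)) p.2 p.1)),
      Finset.sum_eq_single (x, y)]
    · simpa using hxy
    · intro p _ hp
      simp [Pi.single_eq_of_ne hp]
    · simp
  rw [h_half] at hle
  have h1 : 1 / (4 * ((Fintype.card X : ℝ) + Fintype.card Y))
      ≤ 1 / (4 * ((Fintype.card X : ℝ) + Fintype.card Y))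
        * sensitiveMass f (Pi.single (x, y) 1) :=
    le_mul_of_one_le_right (by positivity) hmass
  have h2 := infoCost_nonneg (fun p => hμ.1 p) σ
  have h3 := infoCost_le_maxInfoCost π.1 hν
  linarith

/-- The gain for small error. -/
lemma exists_IC_le_of_small [Nonempty X] [Nonempty Y] {f : X × Y → Z}
    (hf : ∃ a b, f a ≠ f b) :
    ∃ c > 0, ∃ ε₀ > 0, ε₀ < 1 ∧ ∀ ε, 0 ≤ ε → ε ≤ ε₀ → IC f ε ≤ IC f 0 - c * h ε := by
  obtain ⟨x₀, y₀, hcheap⟩ := exists_cheaper_protocol f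
  have hlow := le_IC_zero hf
  have hX : (1 : ℝ) ≤ Fintype.card X := Nat.one_le_cast.2 Fintype.card_pos
  have hY : (1 : ℝ) ≤ Fintype.card Y := Nat.one_le_cast.2 Fintype.card_pos
  set N : ℝ := Fintype.card X + Fintype.card Y with hN
  have hNpos : 0 < N := by linarith
  have hlog : 0 < Real.log 2 := Real.log_pos one_lt_two
  -- The threshold, in bits, is half the lower bound on `IC f 0`. The pair `(x₀, y₀)` depends on `f`
  -- alone, so `η'` and the final constant do not depend on the protocol.
  obtain ⟨η', hη', hent⟩ := exists_inputEntropy_le x₀ y₀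
    (show 0 < 1 / (8 * N) * Real.log 2 by positivity)
  -- Both `ε` and the sensitive mass can take up to `η` from the mass at `(x₀, y₀)`, hence `η' / 2`.
  set η := min (η' / 2) (1 / 2) with hηdef
  have hη : 0 < η := lt_min (half_pos hη') (by norm_num)
  have hη1 : η ≤ 1 / 2 := min_le_right _ _
  have hη2 : η ≤ η' / 2 := min_le_left _ _
  refine ⟨η / (8 * N), by positivity, η, hη, by linarith, fun ε hε hεη => ?_⟩
  have hh0 : 0 ≤ h ε := h_nonneg hε (by linarith)
  have hhalf : 1 / 2 * h ε ≤ h (ε / 2) := by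
    have := mul_h_le (t := 1 / 2) (x := ε) (by norm_num) (by norm_num) hε (by linarith)
    rwa [one_div_mul_eq_div 2 ε] at this
  refine le_of_forall_pos_le_add fun δ hδ => ?_
  have := nonempty_performs f le_rfl
  obtain ⟨⟨π, hπ⟩, hlt⟩ := exists_lt_of_ciInf_lt
    (show (⨅ π : {π : Protocol X Y Z // π.Performs f 0}, π.1.maxInfoCost) < IC f 0 + δ from
      lt_add_of_pos_right _ hδ)
  obtain ⟨σ, hσ, hσμ⟩ := hcheap π hπ (ε / 2) (by linarith) (by linarith)
  rw [mul_div_cancel₀ ε two_ne_zero] at hσ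
  refine (IC_le_maxInfoCost hσ).trans ?_
  have : Nonempty (stdSimplex ℝ (X × Y)) := by
    classical
    exact ⟨⟨_, single_mem_stdSimplex ℝ (x₀, y₀)⟩⟩
  refine ciSup_le fun μ => ?_
  obtain ⟨ν, hν, hgain, hpt⟩ := hσμ μ μ.2
  rw [mul_div_cancel₀ ε two_ne_zero] at hpt
  have hmax := infoCost_le_maxInfoCost π hν
  dsimp only at hlt
  -- With large sensitive mass the noise gain suffices. Otherwise `ν` is concentrated and the cost
  -- is at most `1 / (8N)`, which lies below `IC f 0` by at least `1 / (8N)`.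
  rcases le_total η (sensitiveMass f μ) with hbig | hsmall
  · have h1 : η / (8 * N) * h ε ≤ h (ε / 2) / (4 * N) * sensitiveMass f μ := by
      calc η / (8 * N) * h ε = (1 / 2 * h ε) / (4 * N) * η := by field_simp; ring
        _ ≤ h (ε / 2) / (4 * N) * sensitiveMass f μ :=
            mul_le_mul (div_le_div_of_nonneg_right hhalf (by positivity)) hbig hη.le
              (div_nonneg (by linarith) (by positivity))
    linarith
  · have hs0 : 0 ≤ sensitiveMass f μ := Finset.sum_nonneg fun x _ =>
      sum_mul_nonneg_of_nonneg (fun y => μ.2.1 _) fun y =>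
        add_nonneg (sensitiveLeft_nonneg _ _ _) (sensitiveLeft_nonneg _ _ _)
    have h1 := hent (fun x y => ν (x, y)) (fun x y => hν.1 _)
      (by rw [← Fintype.sum_prod_type, hν.2]) (by linarith)
    have h2 : infoCost ν π ≤ 1 / (8 * N) :=
      (infoCost_le_inputEntropy hν.1 π).trans ((div_le_iff₀ hlog).2 h1)
    have h3 : 0 ≤ h (ε / 2) / (4 * N) * sensitiveMass f μ :=
      mul_nonneg (div_nonneg (by linarith) (by positivity)) hs0
    have h4 : η / (8 * N) * h ε ≤ 1 / (8 * N) := by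
      calc η / (8 * N) * h ε ≤ 1 / (8 * N) * 1 :=
            mul_le_mul (div_le_div_of_nonneg_right (by linarith) (by positivity)) (h_le_one ε)
              hh0 (by positivity)
        _ = 1 / (8 * N) := mul_one _
    have h5 : 1 / (4 * N) = 1 / (8 * N) + 1 / (8 * N) := by field_simp; norm_num
    linarith

end InformationComplexity

end InfoComplexity

theorem mainTheorem9 {X Y Z : Type*} [Fintype X] [Fintype Y] (f : X × Y → Z)
    (hf : ∃ a b, f a ≠ f b) :
    ∃ c : ℝ, 0 < c ∧ ∀ ε : ℝ, 0 ≤ ε → ε ≤ 1 →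
      InfoComplexity.IC f ε ≤ InfoComplexity.IC f 0 - c * InfoComplexity.h ε := by
  have hXY : Nonempty X ∧ Nonempty Y := by
    obtain ⟨⟨x, y⟩, -⟩ := hf
    exact ⟨⟨x⟩, ⟨y⟩⟩
  have := hXY.1
  have := hXY.2
  obtain ⟨c, hc, ε₀, hε₀, hε₀1, hsmall⟩ := InfoComplexity.exists_IC_le_of_small hf
  have hpos : 0 < InfoComplexity.h ε₀ :=
    div_pos (Real.binEntropy_pos hε₀ hε₀1) (Real.log_pos one_lt_two)
  -- Beyond `ε₀` the saving `c * h ε₀` persists by monotonicity, and `h ε ≤ 1` makes it enough;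
  -- below `ε₀` the extra factor `h ε₀ ≤ 1` only weakens the claim.
  refine ⟨c * InfoComplexity.h ε₀, mul_pos hc hpos, fun ε hε hε1 => ?_⟩
  rcases le_total ε ε₀ with hle | hge
  · have h1 := mul_le_mul_of_nonneg_left (InfoComplexity.h_le_one ε₀)
      (mul_nonneg hc.le (InfoComplexity.h_nonneg hε hε1))
    have h2 := hsmall ε hε hle
    linarith
  · have h1 := mul_le_mul_of_nonneg_left (InfoComplexity.h_le_one ε) (mul_pos hc hpos).le
    have h2 := hsmall ε₀ hε₀.le le_rfl
    have h3 := InfoComplexity.IC_anti f hε₀.le hge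
    linarith
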